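/- For $n\ge 2$ let $K_n$ be the complete graph on $n$ labelled vertices. A subtree of $K_n$ is a subgraph of $K_n$ (a set of vertices together with a set of edges between them) that is a tree and has at least one edge; it is a spanning tree if it contains all $n$ vertices. (1) Let $p_n$ be the probability of choosing a spanning tree when a subtree of $K_n$ is chosen uniformly at random among all subtrees of $K_n$. Then $\lim_{n\to\infty}p_n=e^{-e^{-1}}$. (2) Let $q_n$ be the probability of choosing a spanning tree when a subtree of $K_n$ is chosen at random among all subtrees of $K_n$, each with probability proportional to its number of edges. Then $\lim_{n\to\infty}q_n=e^{-e^{-1}}$. Numerically, $e^{-e^{-1}}\approx 0.692201$, rounded to six decimal places. -/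

import Mathlib

open Filter Topology

namespace RandomSubtree

open Classical in
/-- The subtrees of a finite graph `G` that have at least one edge. They are labelled: two subtrees
are equal iff they have the same vertices and the same edges. -/
noncomputable def subtrees {V : Type*} [Fintype V] (G : SimpleGraph V) : Finset G.Subgraph :=
  {T : G.Subgraph | T.coe.IsTree ∧ T.edgeSet.Nonempty}

/-- The number of edges of a subgraph. -/
noncomputable def size {V : Type*} {G : SimpleGraph V} (T : G.Subgraph) : ℕ :=
  T.edgeSet.ncard

/-- The probability that the subtree `T` of `G` is selected, when each subtree is selected with a
probability proportional to its weight `w`. -/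
noncomputable def pr {V : Type*} [Fintype V] (G : SimpleGraph V) (w : G.Subgraph → ℝ)
    (T : G.Subgraph) : ℝ :=
  w T / ∑ T' ∈ subtrees G, w T'

open Classical in
/-- The probability that the selected subtree of `G` is a spanning tree, when each subtree is
selected with a probability proportional to its weight `w`. -/
noncomputable def spanningProb {V : Type*} [Fintype V] (G : SimpleGraph V)
    (w : G.Subgraph → ℝ) : ℝ :=
  ∑ T ∈ subtrees G with T.IsSpanning, pr G w T

/-- The probability that a uniformly random subtree of `K_n` is a spanning tree
(meaningful for `2 ≤ n`). -/
noncomputable def p (n : ℕ) : ℝ :=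
  spanningProb (⊤ : SimpleGraph (Fin n)) (fun _ => 1)

/-- The probability that a random subtree of `K_n`, selected with a probability proportional to its
number of edges, is a spanning tree (meaningful for `2 ≤ n`). -/
noncomputable def q (n : ℕ) : ℝ :=
  spanningProb (⊤ : SimpleGraph (Fin n)) (fun T => (size T : ℝ))

end RandomSubtree

namespace RandomSubtree

/-! A subtree of `K_n` missing `j` vertices amounts to a vertex set of size `n - j` with a tree on
it, so by Cayley's formula (`card_isTree`) their number divided by that of the spanning trees is
`missingRatio n j`. For fixed `j` this tends to `e⁻ʲ / j!`, and it is at most `1 / j!` uniformly in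
`n`. By dominated convergence the sum over `j` tends to `exp (e⁻¹)`, and `p n` is its reciprocal.
Weighting by edges only inserts the factor `(n - j - 1) / (n - 1)`, which is bounded by `1` and
tends to `1`, so `q` has the same limit.

Cayley's formula comes from the rooted-forest count `card_forestFuns`, proved by induction on the
number of non-roots by removing the roots and promoting their children to roots. A tree with a
chosen vertex `r` is then identified with its parent function towards `r`. -/

open Classical in
/-- The parent functions of the rooted forests with root set `A` and set of non-roots `B`. -/
noncomputable def forestFuns {V : Type*} [Fintype V] (A B : Finset V) : Finset (V → V) :=
  {f | (∀ v ∉ B, f v = v) ∧ ∀ v ∈ B, ∃ k, f^[k] v ∈ A}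

lemma mem_forestFuns {V : Type*} [Fintype V] {A B : Finset V} {f : V → V} : f ∈ forestFuns A B ↔
    (∀ v ∉ B, f v = v) ∧ ∀ v ∈ B, ∃ k, f^[k] v ∈ A := by
  simp [forestFuns]

lemma forestFuns_empty {V : Type*} [Fintype V] {A : Finset V} : forestFuns A ∅ = {id} := by
  ext f
  simp only [mem_forestFuns, Finset.mem_singleton]
  constructor
  · rintro ⟨h, -⟩
    funext v
    exact h v (by simp)
  · rintro rfl
    simp

/-! ### Counting rooted forests -/

section Forest

variable {V : Type*} {A B S : Finset V} {f g : V → V}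

variable [DecidableEq V]

/-- Vertices outside `B` are fixed by `f`, so an orbit from `B` to `A` stays in `B` until its last
step, which starts in `S`; up to there `g` follows `f`. -/
lemma iterate_mem_of_leaves_eq (hAB : Disjoint A B)
    (hf : ∀ v ∉ B, f v = v) (hS : ∀ v, v ∈ S ↔ v ∈ B ∧ f v ∈ A)
    (hg : ∀ v ∉ S, g v = f v) (k : ℕ) :
    ∀ v ∈ B, f^[k] v ∈ A → ∃ m, g^[m] v ∈ S := by
  induction k with
  | zero => exact fun v hv h => absurd hv (Finset.disjoint_left.1 hAB h)
  | succ k ih =>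
    intro v hv h
    by_cases hvS : v ∈ S
    · exact ⟨0, hvS⟩
    have hfv : f v ∈ B := by
      by_contra hfB
      rw [Function.iterate_succ_apply, Function.iterate_fixed (hf _ hfB)] at h
      exact hvS ((hS v).2 ⟨hv, h⟩)
    obtain ⟨m, hm⟩ := ih (f v) hfv h
    exact ⟨m + 1, by rwa [Function.iterate_succ_apply, hg v hvS]⟩

lemma iterate_mem_of_piecewise (hSB : S ⊆ B) (hg : ∀ v ∉ B \ S, g v = v)
    (hfS : ∀ v ∈ S, f v ∈ A) (hf : ∀ v ∉ S, f v = g v) (k : ℕ) :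
    ∀ v ∈ B, g^[k] v ∈ S → ∃ m, f^[m] v ∈ A := by
  induction k with
  | zero => exact fun v _ h => ⟨1, hfS v h⟩
  | succ k ih =>
    intro v hv h
    by_cases hvS : v ∈ S
    · exact ⟨1, hfS v hvS⟩
    have hgv : g v ∈ B := by
      by_contra hgB
      rw [Function.iterate_succ_apply,
        Function.iterate_fixed (hg _ fun hm => hgB (Finset.mem_sdiff.1 hm).1)] at h
      exact hgB (hSB h)
    obtain ⟨m, hm⟩ := ih (g v) hgv h
    exact ⟨m + 1, by rwa [Function.iterate_succ_apply, hf v hvS]⟩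

variable [Fintype V]

/-- Forests in which `S` is the set of children of the roots. -/
lemma card_forestFuns_filter (hAB : Disjoint A B) (hSB : S ⊆ B) :
    ((forestFuns A B).filter fun f => B.filter (fun v => f v ∈ A) = S).card =
      A.card ^ S.card * (forestFuns S (B \ S)).card := by
  have hpi : (Fintype.piFinset fun v => if v ∈ S then A else {v}).card = A.card ^ S.card := by
    rw [Fintype.card_piFinset]
    simp only [apply_ite Finset.card, Finset.card_singleton]
    rw [Finset.prod_ite_mem, Finset.univ_inter, Finset.prod_const]
  rw [← hpi, ← Finset.card_product]
  -- Split `f` into the choice of a root for each child in `S` and the forest on `B \ S` rooted at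
  -- `S`; each part is the identity elsewhere.
  refine Finset.card_nbij'
    (fun f => (fun v => if v ∈ S then f v else v, fun v => if v ∈ S then v else f v))
    (fun x v => if v ∈ S then x.1 v else x.2 v) ?_ ?_ ?_ ?_
  · intro f hf
    simp only [Finset.coe_filter, Set.mem_ofPred_eq, mem_forestFuns] at hf
    obtain ⟨⟨hf1, hf2⟩, hS⟩ := hf
    have hS' : ∀ v, v ∈ S ↔ v ∈ B ∧ f v ∈ A := fun v => by rw [← hS]; simp
    simp only [Finset.coe_product, Set.mem_prod, Finset.mem_coe, Fintype.mem_piFinset,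
      mem_forestFuns]
    refine ⟨fun v => ?_, fun v hv => ?_, fun v hv => ?_⟩
    · by_cases hv : v ∈ S
      · simpa [hv] using ((hS' v).1 hv).2
      · simp [hv]
    · by_cases hvS : v ∈ S
      · simp [hvS]
      · simpa [hvS] using hf1 v fun hB => hv (Finset.mem_sdiff.2 ⟨hB, hvS⟩)
    · obtain ⟨k, hk⟩ := hf2 v (Finset.mem_sdiff.1 hv).1
      exact iterate_mem_of_leaves_eq hAB hf1 hS' (fun v hv => by simp [hv]) k v
        (Finset.mem_sdiff.1 hv).1 hk
  · rintro ⟨h, g⟩ hx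
    simp only [Finset.coe_product, Set.mem_prod, Finset.mem_coe, Fintype.mem_piFinset,
      mem_forestFuns] at hx
    obtain ⟨hh, hg1, hg2⟩ := hx
    have hhA : ∀ v ∈ S, h v ∈ A := fun v hv => by simpa [hv] using hh v
    simp only [Finset.coe_filter, Set.mem_ofPred_eq, mem_forestFuns]
    -- A vertex sent into `A` by `g` would be stuck there, outside `B`, and never reach `S`.
    have hgA : ∀ v ∈ B, v ∉ S → g v ∉ A := fun v hv hvS hA => by
      have hgB := Finset.disjoint_left.1 hAB hA
      obtain ⟨k, hk⟩ := hg2 v (Finset.mem_sdiff.2 ⟨hv, hvS⟩)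
      cases k with
      | zero => exact hvS hk
      | succ k =>
        rw [Function.iterate_succ_apply,
          Function.iterate_fixed (hg1 _ fun hm => hgB (Finset.mem_sdiff.1 hm).1)] at hk
        exact hgB (hSB hk)
    refine ⟨⟨fun v hv => ?_, fun v hv => ?_⟩, ?_⟩
    · rw [if_neg fun h => hv (hSB h)]
      exact hg1 v fun hm => hv (Finset.mem_sdiff.1 hm).1
    · have key := iterate_mem_of_piecewise (A := A) (f := fun v => if v ∈ S then h v else g v)
        hSB hg1 (fun v hv => by simpa [hv] using hhA v hv) (fun v hv => by simp [hv])
      by_cases hvS : v ∈ S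
      · exact key 0 v hv hvS
      · obtain ⟨k, hk⟩ := hg2 v (Finset.mem_sdiff.2 ⟨hv, hvS⟩)
        exact key k v hv hk
    · ext v
      by_cases hvS : v ∈ S
      · simp [hvS, hhA v hvS, hSB hvS]
      · simpa [hvS] using fun hv => hgA v hv hvS
  · intro f _
    funext v
    by_cases hv : v ∈ S <;> simp [hv]
  · rintro ⟨h, g⟩ hx
    simp only [Finset.coe_product, Set.mem_prod, Finset.mem_coe, Fintype.mem_piFinset,
      mem_forestFuns] at hx
    obtain ⟨hh, hg1, -⟩ := hx
    refine Prod.ext ?_ ?_ <;> funext v <;> by_cases hv : v ∈ S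
    · simp [hv]
    · have := hh v
      simp only [hv, if_false, Finset.mem_singleton] at this
      simp [hv, this]
    · simpa [hv] using (hg1 v (by simp [hv])).symm
    · simp [hv]

lemma card_forestFuns_eq_sum (hAB : Disjoint A B) :
    (forestFuns A B).card =
      ∑ S ∈ B.powerset, A.card ^ S.card * (forestFuns S (B \ S)).card := by
  rw [Finset.card_eq_sum_card_fiberwise (f := fun f : V → V => B.filter fun v => f v ∈ A)
    (t := B.powerset)]
  · refine Finset.sum_congr rfl fun S hS => ?_
    exact card_forestFuns_filter hAB (Finset.mem_powerset.1 hS)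
  · intro f _
    exact Finset.mem_coe.2 (Finset.mem_powerset.2 (Finset.filter_subset _ _))

end Forest

/-- The term `s = 0` vanishes; absorbing `s` into the binomial coefficient turns the rest into the
binomial expansion of `a * (a + (b + 1)) ^ b`. -/
lemma sum_choose_mul_forest_count (a b : ℕ) :
    ∑ s ∈ Finset.range (b + 2), (b + 1).choose s *
      (a ^ s * if b + 1 - s = 0 then 1 else s * (b + 1) ^ (b + 1 - s - 1)) =
      a * (a + (b + 1)) ^ b := by
  rw [Finset.sum_range_succ', add_pow a (b + 1) b, Finset.mul_sum]
  rw [if_neg (by omega : ¬b + 1 - 0 = 0), zero_mul, mul_zero, mul_zero, add_zero]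
  refine Finset.sum_congr rfl fun s hs => ?_
  have hs' : s ≤ b := Nat.lt_succ_iff.1 (Finset.mem_range.1 hs)
  obtain ⟨c, rfl⟩ := Nat.exists_eq_add_of_le hs'
  have e : s + c + 1 - (s + 1) = c := by omega
  rw [e, Nat.add_sub_cancel_left]
  have := Nat.add_one_mul_choose_eq (s + c) s
  -- `c = 0` is the term `S = B`, where the forest count is `1` by convention.
  cases c with
  | zero => simp [pow_succ']
  | succ c =>
    simp only [Nat.add_eq_zero_iff, one_ne_zero, and_false, if_false, Nat.add_sub_cancel]
    calc _ = a ^ (s + 1) * (s + (c + 1) + 1) ^ c *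
          ((s + (c + 1) + 1).choose (s + 1) * (s + 1)) := by ring
      _ = _ := by rw [← this, Nat.cast_id]; ring

/-- The number of rooted forests with `a` prescribed roots and `b` further vertices is
`a * (a + b) ^ (b - 1)`. -/
theorem card_forestFuns {V : Type*} [Fintype V] {A B : Finset V} (hAB : Disjoint A B) :
    (forestFuns A B).card =
      if B.card = 0 then 1 else A.card * (A.card + B.card) ^ (B.card - 1) := by
  classical
  induction hb : B.card using Nat.strong_induction_on generalizing A B with
  | _ b ih =>
  cases b with
  | zero => simp [Finset.card_eq_zero.1 hb, forestFuns_empty]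
  | succ b =>
    simp only [Nat.add_eq_zero_iff, one_ne_zero, and_false, if_false, Nat.add_sub_cancel]
    rw [card_forestFuns_eq_sum hAB, ← sum_choose_mul_forest_count,
      show b + 2 = B.card + 1 by omega, ← hb]
    simp only [← smul_eq_mul (B.card.choose _)]
    rw [← Finset.sum_powerset_apply_card (fun s => A.card ^ s *
        if B.card - s = 0 then 1 else s * B.card ^ (B.card - s - 1))]
    refine Finset.sum_congr rfl fun S hS => ?_
    have hSB := Finset.mem_powerset.1 hS
    congr 1
    have hc := Finset.card_sdiff_of_subset hSB
    have hle := Finset.card_le_card hSB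
    -- For `S = ∅` the set `B \ S` is no smaller than `B`, so the induction hypothesis is
    -- unavailable; both sides are `0`.
    rcases S.eq_empty_or_nonempty with rfl | hne
    · have : forestFuns (∅ : Finset V) B = ∅ := by
        refine Finset.eq_empty_of_forall_notMem fun f hf => ?_
        obtain ⟨v, hv⟩ := Finset.card_pos.1 (by omega : 0 < B.card)
        simpa using (mem_forestFuns.1 hf).2 v hv
      simp [this, hb]
    · have hpos := hne.card_pos
      rw [ih (B.card - S.card) (by omega) Finset.disjoint_sdiff hc, Nat.add_sub_cancel' hle]

/-! ### Trees as parent functions, and Cayley's formula -/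

/-- The functional graph of `f`, with loops removed. -/
def funGraph {V : Type*} (f : V → V) : SimpleGraph V :=
  SimpleGraph.fromRel fun a b => f a = b

section Tree

variable {V : Type*}

lemma funGraph_adj {f : V → V} {a b : V} :
    (funGraph f).Adj a b ↔ a ≠ b ∧ (f a = b ∨ f b = a) := by
  simp [funGraph]

lemma funGraph_connected {f : V → V} {r : V} (h : ∀ v, ∃ k, f^[k] v = r) :
    (funGraph f).Connected := by
  have hr : ∀ k v, (funGraph f).Reachable v (f^[k] v) := by
    intro k
    induction k with
    | zero => exact fun v => .refl _
    | succ k ih =>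
      intro v
      refine .trans ?_ (ih (f v))
      by_cases hv : v = f v
      · rw [← hv]
      · exact (funGraph_adj.2 ⟨hv, .inl rfl⟩ : (funGraph f).Adj v (f v)).reachable
  have hr' : ∀ v, (funGraph f).Reachable v r := fun v => by
    obtain ⟨k, hk⟩ := h v
    exact hk ▸ hr k v
  exact { preconnected := fun u v => (hr' u).trans (hr' v).symm, nonempty := ⟨r⟩ }

/-- Each edge is `s(v, f v)` for some `v ≠ r`, so this connected graph has at most `|V| - 1` edges.
-/
lemma funGraph_isTree [Fintype V] {f : V → V} {r : V} (h : ∀ v, ∃ k, f^[k] v = r)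
    (hr : f r = r) : (funGraph f).IsTree := by
  classical
  have hc := funGraph_connected h
  rw [SimpleGraph.isTree_iff_connected_and_card]
  refine ⟨hc, le_antisymm ?_ hc.card_vert_le_card_edgeSet_add_one⟩
  have hsub : (funGraph f).edgeSet ⊆
      ((Finset.univ.erase r).image fun v => s(v, f v) : Finset (Sym2 V)) := by
    intro e
    induction e with
    | _ a b =>
    intro he
    obtain ⟨hne, hab⟩ := funGraph_adj.1 ((SimpleGraph.mem_edgeSet _).1 he)
    simp only [Finset.coe_image, Set.mem_image, Finset.mem_coe, Finset.mem_erase,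
      Finset.mem_univ, and_true]
    rcases hab with rfl | rfl
    · exact ⟨a, fun e => hne (by rw [e, hr]), rfl⟩
    · exact ⟨b, fun e => hne (by rw [e, hr]), Sym2.eq_swap⟩
  have h1 := Set.ncard_le_ncard hsub (Finset.finite_toSet _)
  rw [Set.ncard_coe_finset] at h1
  have h2 := h1.trans Finset.card_image_le
  rw [Finset.card_erase_of_mem (Finset.mem_univ r), Finset.card_univ] at h2
  have h3 : 0 < Fintype.card V := Fintype.card_pos_iff.2 ⟨r⟩
  rw [Nat.card_eq_fintype_card (α := V)]
  change Set.ncard _ + 1 ≤ _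
  omega

/-- Induction on the number of steps to `r`. The edge from `v` to `f v` also comes from `g`; if `g`
used it backwards, `f` and `g` would agree at `f v`, so `f` would swap `v` and `f v`, and `v` could
reach `r` only if `f v = r`, contradicting `g r = r`. -/
lemma funGraph_injective {f g : V → V} {r : V} (hf : ∀ v, ∃ k, f^[k] v = r) (hfr : f r = r)
    (hgr : g r = r) (h : funGraph f = funGraph g) : f = g := by
  have key : ∀ k v, f^[k] v = r → f v = g v := by
    intro k
    induction k with
    | zero => rintro v rfl; rw [Function.iterate_zero_apply] at *; rw [hfr, hgr]
    | succ k ih =>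
      intro v hv
      by_cases hvr : v = r
      · rw [hvr, hfr, hgr]
      have hne : v ≠ f v := fun e => by
        rw [Function.iterate_fixed e.symm] at hv
        exact hvr hv
      have hadj : (funGraph g).Adj v (f v) := h ▸ funGraph_adj.2 ⟨hne, .inl rfl⟩
      rcases (funGraph_adj.1 hadj).2 with e | e
      · exact e.symm
      · have e2 : f (f v) = v := (ih (f v) hv).trans e
        have hper : ∀ m, f^[m] v = v ∨ f^[m] v = f v := by
          intro m
          induction m with
          | zero => exact .inl rfl
          | succ m im =>
            rw [Function.iterate_succ_apply']
            rcases im with im | im <;> rw [im]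
            · exact .inr rfl
            · exact .inl e2
        rcases hper (k + 1) with e3 | e3
        · exact absurd (e3.symm.trans hv) hvr
        · have hfv := e3.symm.trans hv
          rw [hfv, hgr] at e
          exact absurd e.symm hvr
  funext v
  obtain ⟨k, hk⟩ := hf v
  exact key k v hk

/-- The parent of `v` is a neighbour one step closer to `r`. The resulting graph is a connected
subgraph of `G` on all vertices, hence equals `G`, since trees are minimal connected graphs. -/
lemma exists_funGraph_eq {G : SimpleGraph V} (hG : G.IsTree) (r : V) :
    ∃ f : V → V, (∀ v, ∃ k, f^[k] v = r) ∧ f r = r ∧ funGraph f = G := by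
  classical
  have hstep : ∀ v, v ≠ r → ∃ w, G.Adj v w ∧ G.dist w r + 1 = G.dist v r := by
    intro v hv
    obtain ⟨p, hp⟩ := hG.connected.exists_walk_length_eq_dist v r
    cases p with
    | nil => exact absurd rfl hv
    | @cons _ w _ hadj p =>
      refine ⟨w, hadj, ?_⟩
      have h1 := SimpleGraph.dist_le p
      have h2 := hG.connected.dist_triangle (u := v) (v := w) (w := r)
      rw [SimpleGraph.dist_eq_one_iff_adj.2 hadj] at h2
      simp only [SimpleGraph.Walk.length_cons] at hp
      omega
  choose! p hp1 hp2 using hstep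
  let f : V → V := fun v => if v = r then r else p v
  have hf : ∀ v, v ≠ r → f v = p v := fun v hv => by simp [f, hv]
  have hfr : f r = r := by simp [f]
  have hit : ∀ k v, G.dist v r = k → f^[k] v = r := by
    intro k
    induction k with
    | zero => exact fun v hv => hG.connected.dist_eq_zero_iff.1 hv
    | succ k ih =>
      intro v hv
      have hvr : v ≠ r := by rintro rfl; simp at hv
      rw [Function.iterate_succ_apply]
      refine ih _ ?_
      have := hp2 v hvr
      rw [hf v hvr]
      omega
  have hit' : ∀ v, ∃ k, f^[k] v = r := fun v => ⟨_, hit _ v rfl⟩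
  refine ⟨f, hit', hfr, ?_⟩
  have hle : funGraph f ≤ G := by
    intro a b hab
    obtain ⟨hne, h | h⟩ := funGraph_adj.1 hab
    · have ha : a ≠ r := fun e => hne (by rw [← h, e, hfr])
      rw [← h, hf a ha]
      exact hp1 a ha
    · have hb : b ≠ r := fun e => hne (by rw [← h, e, hfr])
      rw [← h, hf b hb]
      exact (hp1 b hb).symm
  exact le_antisymm hle
    ((SimpleGraph.isTree_iff_minimal_connected.1 hG).2 (funGraph_connected hit') hle)

open Classical in
/-- **Cayley's formula**. -/
theorem card_isTree [Fintype V] (hV : 2 ≤ Fintype.card V) :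
    (Finset.univ.filter fun G : SimpleGraph V => G.IsTree).card =
      Fintype.card V ^ (Fintype.card V - 2) := by
  obtain ⟨r⟩ : Nonempty V := Fintype.card_pos_iff.1 (by omega)
  have hmem : ∀ f : V → V, f ∈ forestFuns {r} (Finset.univ.erase r) ↔
      f r = r ∧ ∀ v, ∃ k, f^[k] v = r := by
    intro f
    rw [mem_forestFuns]
    simp only [Finset.mem_erase, Finset.mem_univ, and_true, not_not, forall_eq,
      Finset.mem_singleton]
    refine and_congr_right fun _ => ⟨fun h v => ?_, fun h v _ => h v⟩
    by_cases hv : v = r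
    · exact ⟨0, hv⟩
    · exact h v hv
  have hcard : (forestFuns {r} (Finset.univ.erase r)).card =
      Fintype.card V ^ (Fintype.card V - 2) := by
    rw [card_forestFuns (by simp), Finset.card_erase_of_mem (Finset.mem_univ r),
      Finset.card_univ, if_neg (by omega), Finset.card_singleton, one_mul,
      Nat.add_sub_cancel' (by omega), Nat.sub_sub]
  rw [← hcard]
  symm
  refine Finset.card_nbij funGraph ?_ ?_ ?_
  · intro f hf
    obtain ⟨h1, h2⟩ := (hmem f).1 hf
    simpa using funGraph_isTree h2 h1
  · intro f hf g hg h
    exact funGraph_injective ((hmem f).1 hf).2 ((hmem f).1 hf).1 ((hmem g).1 hg).1 h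
  · intro G hG
    obtain ⟨f, h1, h2, h3⟩ := exists_funGraph_eq (by simpa using hG) r
    exact ⟨f, (hmem f).2 ⟨h2, h1⟩, h3⟩

end Tree

/-! ### Counting subtrees of the complete graph by vertex set -/

section Subtrees

variable {V : Type*}

/-- The subgraph of the complete graph on `V` given by a graph on a set of vertices. -/
def subgraphOn (W : Set V) (G : SimpleGraph W) : (⊤ : SimpleGraph V).Subgraph where
  verts := W
  Adj a b := ∃ (ha : a ∈ W) (hb : b ∈ W), G.Adj ⟨a, ha⟩ ⟨b, hb⟩
  adj_sub := by
    rintro a b ⟨ha, hb, h⟩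
    exact fun e => h.ne (Subtype.ext e)
  edge_vert := fun ⟨ha, _, _⟩ => ha
  symm := ⟨fun _ _ ⟨ha, hb, h⟩ => ⟨hb, ha, h.symm⟩⟩

lemma coe_subgraphOn (W : Set V) (G : SimpleGraph W) : (subgraphOn W G).coe = G := by
  ext ⟨a, ha⟩ ⟨b, hb⟩
  exact ⟨fun ⟨_, _, h⟩ => h, fun h => ⟨ha, hb, h⟩⟩

lemma subgraphOn_coe (T : (⊤ : SimpleGraph V).Subgraph) : subgraphOn T.verts T.coe = T := by
  refine SimpleGraph.Subgraph.ext rfl ?_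
  funext a b
  exact propext ⟨fun ⟨_, _, h⟩ => h, fun h => ⟨h.fst_mem, h.snd_mem, h⟩⟩

lemma exists_subgraphOn_eq {T : (⊤ : SimpleGraph V).Subgraph} {W : Set V} (hW : T.verts = W)
    (hT : T.coe.IsTree) : ∃ G : SimpleGraph W, G.IsTree ∧ subgraphOn W G = T := by
  subst hW
  exact ⟨T.coe, hT, subgraphOn_coe T⟩

lemma size_add_one [Finite V] {T : (⊤ : SimpleGraph V).Subgraph} (hT : T.coe.IsTree) :
    size T + 1 = T.verts.ncard := by
  have h := (SimpleGraph.isTree_iff_connected_and_card.1 hT).2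
  rw [size, ← SimpleGraph.Subgraph.image_coe_edgeSet_coe,
    Set.ncard_image_of_injective _ (Sym2.map.injective Subtype.val_injective)]
  exact h

variable [Fintype V]

lemma mem_subtrees {T : (⊤ : SimpleGraph V).Subgraph} :
    T ∈ subtrees ⊤ ↔ T.coe.IsTree ∧ 2 ≤ T.verts.ncard := by
  classical
  simp only [subtrees, Finset.mem_filter, Finset.mem_univ, true_and]
  refine and_congr_right fun h => ?_
  rw [← size_add_one h, size, ← Set.ncard_pos (Set.toFinite _)]
  omega

open Classical in
lemma card_subtrees_filter_verts (W : Finset V) (hW : 2 ≤ W.card) :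
    ((subtrees (⊤ : SimpleGraph V)).filter fun T => T.verts = (W : Set V)).card =
      W.card ^ (W.card - 2) := by
  have hc : Fintype.card (W : Set V) = W.card := by simp
  rw [← hc, ← card_isTree (V := (W : Set V)) (by omega)]
  symm
  refine Finset.card_nbij (subgraphOn (W : Set V)) ?_ ?_ ?_
  · intro G hG
    simp only [Finset.coe_filter, Finset.mem_univ, true_and, Set.mem_ofPred_eq] at hG
    simp only [Finset.coe_filter, mem_subtrees, Set.mem_ofPred_eq]
    refine ⟨⟨?_, ?_⟩, rfl⟩
    · rw [coe_subgraphOn]; exact hG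
    · change 2 ≤ (W : Set V).ncard
      rwa [Set.ncard_coe_finset]
  · intro G _ H _ h
    have hadj := fun a b => congrFun (congrFun (congrArg SimpleGraph.Subgraph.Adj h) a) b
    ext ⟨a, ha⟩ ⟨b, hb⟩
    have := hadj a b
    simp only [subgraphOn, eq_iff_iff] at this
    exact ⟨fun h => (this.1 ⟨ha, hb, h⟩).2.2, fun h => (this.2 ⟨ha, hb, h⟩).2.2⟩
  · intro T hT
    simp only [Finset.coe_filter, mem_subtrees, Set.mem_ofPred_eq] at hT
    obtain ⟨⟨h1, -⟩, h2⟩ := hT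
    obtain ⟨G, hG, hGT⟩ := exists_subgraphOn_eq h2 h1
    exact ⟨G, by simpa using hG, hGT⟩

/-- The number of subtrees of the complete graph with a given set of `k` vertices. -/
def treeCount (k : ℕ) : ℕ := if 2 ≤ k then k ^ (k - 2) else 0

lemma sum_subtrees (w : ℕ → ℝ) :
    ∑ T ∈ subtrees (⊤ : SimpleGraph V), w T.verts.ncard =
      ∑ k ∈ Finset.range (Fintype.card V + 1),
        (Fintype.card V).choose k * (treeCount k * w k) := by
  classical
  have h := Finset.sum_powerset_apply_card (fun k => (treeCount k * w k : ℝ))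
    (x := (Finset.univ : Finset V))
  simp only [nsmul_eq_mul, Finset.card_univ] at h
  rw [← h, ← Finset.sum_fiberwise_of_maps_to (g := fun T => T.verts.toFinset)
    (t := Finset.univ.powerset) (by simp)]
  refine Finset.sum_congr rfl fun W _ => ?_
  have hW : ∀ T : (⊤ : SimpleGraph V).Subgraph, T.verts.toFinset = W ↔ T.verts = W := by
    intro T
    rw [← Finset.coe_inj, Set.coe_toFinset]
  simp only [hW]
  rw [Finset.sum_congr rfl (g := fun _ => w W.card), Finset.sum_const, nsmul_eq_mul, treeCount]
  · split_ifs with h2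
    · rw [card_subtrees_filter_verts W h2]
    · rw [Finset.filter_false_of_mem, Finset.card_empty]
      intro T hT e
      have hT2 := (mem_subtrees.1 hT).2
      rw [e, Set.ncard_coe_finset] at hT2
      exact h2 hT2
  · intro T hT
    rw [(Finset.mem_filter.1 hT).2, Set.ncard_coe_finset]

/-- Serves both models, as the weight of a subtree with `k` vertices is `1` or `k - 1`. -/
lemma spanningProb_top (w : ℕ → ℝ) (w' : (⊤ : SimpleGraph V).Subgraph → ℝ)
    (hw : ∀ T ∈ subtrees ⊤, w' T = w T.verts.ncard) (hV : 2 ≤ Fintype.card V) :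
    spanningProb (⊤ : SimpleGraph V) w' =
      (Fintype.card V ^ (Fintype.card V - 2) * w (Fintype.card V)) /
      ∑ k ∈ Finset.range (Fintype.card V + 1),
        (Fintype.card V).choose k * (treeCount k * w k) := by
  classical
  rw [← sum_subtrees, ← Finset.sum_congr rfl hw, spanningProb]
  simp only [pr]
  rw [← Finset.sum_div]
  congr 1
  have h := card_subtrees_filter_verts (Finset.univ : Finset V) hV
  simp only [Finset.coe_univ, ← SimpleGraph.Subgraph.isSpanning_iff, Finset.card_univ] at h
  rw [Finset.sum_congr rfl (g := fun _ => w (Fintype.card V)), Finset.sum_const, nsmul_eq_mul]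
  · congr 1
    rw [← Nat.cast_pow, ← h]
  · intro T hT
    obtain ⟨h1, h2⟩ := Finset.mem_filter.1 hT
    rw [hw T h1, SimpleGraph.Subgraph.isSpanning_iff.1 h2, Set.ncard_univ,
      Nat.card_eq_fintype_card]

end Subtrees

/-! ### Limits of the two probabilities -/

lemma p_eq {n : ℕ} (hn : 2 ≤ n) :
    p n = n ^ (n - 2) / ∑ k ∈ Finset.range (n + 1), n.choose k * (treeCount k : ℝ) := by
  have h := spanningProb_top (V := Fin n) (fun _ => 1) (fun _ => 1) (fun _ _ => rfl) (by simpa)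
  simpa [p] using h

lemma q_eq {n : ℕ} (hn : 2 ≤ n) :
    q n = (n ^ (n - 2) * (n - 1)) /
      ∑ k ∈ Finset.range (n + 1), n.choose k * (treeCount k * ((k : ℝ) - 1)) := by
  have h := spanningProb_top (V := Fin n) (fun k => (k : ℝ) - 1) (fun T => (size T : ℝ))
    (fun T hT => by
      rw [← size_add_one (mem_subtrees.1 hT).1]
      push_cast
      ring) (by simpa)
  simpa [q] using h

/-- The number of subtrees of the complete graph on `n` vertices missing exactly `j` vertices,
divided by the number of spanning trees. -/
noncomputable def missingRatio (n j : ℕ) : ℝ :=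
  n.choose j * treeCount (n - j) / n ^ (n - 2)

lemma missingRatio_eq {n j : ℕ} (h : j + 2 ≤ n) :
    missingRatio n j = n.choose j / n ^ j * (1 - j / n : ℝ) ^ (n - j - 2) := by
  have hn : (n : ℝ) ≠ 0 := by exact_mod_cast (by omega : n ≠ 0)
  rw [missingRatio, treeCount, if_pos (by omega), one_sub_div hn, div_pow,
    show n - 2 = j + (n - j - 2) by omega, pow_add]
  push_cast [Nat.cast_sub (by omega : j ≤ n)]
  field_simp

lemma missingRatio_eq_zero {n j : ℕ} (h : n < j + 2) : missingRatio n j = 0 := by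
  simp [missingRatio, treeCount, show ¬ 2 ≤ n - j by omega]

lemma missingRatio_nonneg (n j : ℕ) : 0 ≤ missingRatio n j := by
  unfold missingRatio
  positivity

/-- The summable bound, independent of `n`, for dominated convergence. -/
lemma missingRatio_le (n j : ℕ) : missingRatio n j ≤ 1 / j.factorial := by
  rcases lt_or_ge n (j + 2) with h | h
  · rw [missingRatio_eq_zero h]
    positivity
  rw [missingRatio_eq h]
  have hn : (0 : ℝ) < n := by exact_mod_cast (by omega : 0 < n)
  have hj : (j : ℝ) / n ≤ 1 := by
    rw [div_le_one hn]
    exact_mod_cast (by omega : j ≤ n)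
  have h0 : (0 : ℝ) ≤ j / n := by positivity
  calc _ ≤ (1 / j.factorial : ℝ) * 1 := by
        refine mul_le_mul ?_ (pow_le_one₀ (by linarith) (by linarith))
          (pow_nonneg (by linarith) _) (by positivity)
        rw [div_le_iff₀ (by positivity), one_div_mul_eq_div]
        exact Nat.choose_le_pow_div j n
    _ = _ := mul_one _

lemma tendsto_missingRatio (j : ℕ) :
    Tendsto (fun n => missingRatio n j) atTop (𝓝 (Real.exp (-1) ^ j / j.factorial)) := by
  have h1 : Tendsto (fun n : ℕ => (n.choose j : ℝ) / n ^ j) atTop (𝓝 (1 / j.factorial)) := by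
    have hz : ∀ᶠ n : ℕ in atTop, (n ^ j / j.factorial : ℝ) ≠ 0 := by
      filter_upwards [eventually_gt_atTop 0] with n hn
      positivity
    have h := ((Asymptotics.isEquivalent_iff_tendsto_one hz).1
      (isEquivalent_choose j)).div_const (j.factorial : ℝ)
    refine h.congr fun n => ?_
    rw [Pi.div_apply, div_div_eq_mul_div, div_right_comm, mul_div_cancel_right₀ _ (by positivity)]
  have h2 : Tendsto (fun n : ℕ => (1 - j / n : ℝ)) atTop (𝓝 1) := by
    simpa using (tendsto_const_div_atTop_nhds_zero_nat (j : ℝ)).const_sub 1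
  have h3 : Tendsto (fun n : ℕ => (1 - j / n : ℝ) ^ n) atTop (𝓝 (Real.exp (-j))) := by
    simpa [neg_div, ← sub_eq_add_neg] using Real.tendsto_one_add_div_pow_exp (-(j : ℝ))
  -- The exponent `n - j - 2` is `n` less a fixed number of factors, each tending to `1`.
  have h4 := h1.mul (h3.div (h2.pow (j + 2)) (by simp))
  have e : (1 : ℝ) / j.factorial * (Real.exp (-j) / 1 ^ (j + 2)) =
      Real.exp (-1) ^ j / j.factorial := by
    rw [← Real.exp_nat_mul, one_pow, div_one, mul_neg_one]
    ring
  rw [e] at h4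
  refine h4.congr' ?_
  filter_upwards [eventually_ge_atTop (j + 2)] with n hn
  rw [missingRatio_eq hn]
  congr 1
  have hpos : (0 : ℝ) < 1 - j / n := by
    rw [sub_pos, div_lt_one (by exact_mod_cast (by omega : 0 < n))]
    exact_mod_cast (by omega : j < n)
  rw [Pi.div_apply, div_eq_iff (pow_pos hpos _).ne', ← pow_add]
  congr 1
  omega

lemma hasSum_exp_exp : HasSum (fun j : ℕ => Real.exp (-1) ^ j / j.factorial)
    (Real.exp (Real.exp (-1))) := by
  rw [Real.exp_eq_exp_ℝ]
  exact NormedSpace.expSeries_div_hasSum_exp _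

/-- A weighted sum of the ratios converges if the weights are bounded by `1` and tend to `1`. -/
lemma tendsto_tsum_missingRatio (c : ℕ → ℕ → ℝ)
    (hc : ∀ᶠ n in atTop, ∀ j, j + 2 ≤ n → |c n j| ≤ 1)
    (hc1 : ∀ j, Tendsto (fun n => c n j) atTop (𝓝 1)) :
    Tendsto (fun n => ∑' j, missingRatio n j * c n j) atTop (𝓝 (Real.exp (Real.exp (-1)))) := by
  rw [← hasSum_exp_exp.tsum_eq]
  refine tendsto_tsum_of_dominated_convergence (bound := fun j => 1 / (j.factorial : ℝ)) ?_ ?_ ?_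
  · simpa using Real.summable_pow_div_factorial 1
  · intro j
    simpa using (tendsto_missingRatio j).mul (hc1 j)
  · filter_upwards [hc] with n hn j
    rw [norm_mul, Real.norm_of_nonneg (missingRatio_nonneg n j), Real.norm_eq_abs]
    rcases lt_or_ge n (j + 2) with h | h
    · rw [missingRatio_eq_zero h, zero_mul]
      positivity
    · exact (mul_le_of_le_one_right (missingRatio_nonneg n j) (hn j h)).trans
        (missingRatio_le n j)

lemma sum_choose_treeCount_eq_tsum (n : ℕ) (hn : 0 < n) (w : ℕ → ℝ) :
    ∑ k ∈ Finset.range (n + 1), n.choose k * (treeCount k * w k) =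
      n ^ (n - 2) * ∑' j, missingRatio n j * w (n - j) := by
  rw [tsum_eq_sum (s := Finset.range (n + 1)), ← Finset.sum_range_reflect, Finset.mul_sum]
  · refine Finset.sum_congr rfl fun j hj => ?_
    have hj' : j ≤ n := Nat.lt_succ_iff.1 (Finset.mem_range.1 hj)
    rw [show n + 1 - 1 - j = n - j by omega, Nat.choose_symm hj', missingRatio]
    have : (n : ℝ) ≠ 0 := by exact_mod_cast hn.ne'
    field_simp
  · intro j hj
    rw [missingRatio_eq_zero (by simp at hj; omega), zero_mul]

lemma tendsto_p : Tendsto p atTop (𝓝 (Real.exp (-Real.exp (-1)))) := by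
  rw [Real.exp_neg]
  have h := (tendsto_tsum_missingRatio (fun _ _ => 1) (by simp)
    (fun _ => tendsto_const_nhds)).inv₀ (Real.exp_ne_zero _)
  refine h.congr' ?_
  filter_upwards [eventually_ge_atTop 2] with n hn
  have hs := sum_choose_treeCount_eq_tsum n (by omega) fun _ => 1
  simp only [mul_one] at hs ⊢
  have : (n : ℝ) ≠ 0 := by exact_mod_cast (by omega : n ≠ 0)
  rw [p_eq hn, hs, div_mul_cancel_left₀ (pow_ne_zero _ this)]

lemma tendsto_q : Tendsto q atTop (𝓝 (Real.exp (-Real.exp (-1)))) := by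
  rw [Real.exp_neg]
  -- The weight is the edge count relative to a spanning tree. Truncation in `n - j` is harmless, as
  -- `missingRatio` vanishes for `j > n`.
  have h := (tendsto_tsum_missingRatio (fun n j => (((n - j : ℕ) : ℝ) - 1) / (n - 1)) ?_
    ?_).inv₀ (Real.exp_ne_zero _)
  · refine h.congr' ?_
    filter_upwards [eventually_ge_atTop 2] with n hn
    have hs := sum_choose_treeCount_eq_tsum n (by omega) fun k => (k : ℝ) - 1
    have h1 : (n : ℝ) ≠ 0 := by exact_mod_cast (by omega : n ≠ 0)
    rw [q_eq hn, hs, mul_div_mul_left _ _ (pow_ne_zero _ h1)]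
    simp only [← mul_div_assoc]
    rw [tsum_div_const, inv_div]
  · filter_upwards [eventually_ge_atTop 2] with n hn j hj
    have h1 : (2 : ℝ) ≤ n := by exact_mod_cast hn
    have h2 : (j : ℝ) + 2 ≤ n := by exact_mod_cast hj
    have h3 : (0 : ℝ) ≤ j := j.cast_nonneg
    rw [Nat.cast_sub (by omega), abs_of_nonneg (div_nonneg (by linarith) (by linarith)),
      div_le_one (by linarith)]
    linarith
  · intro j
    have h0 : Tendsto (fun n : ℕ => (n : ℝ) - 1) atTop atTop :=
      tendsto_atTop_add_const_right _ _ tendsto_natCast_atTop_atTop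
    have h1 := (h0.const_div_atTop (j : ℝ)).const_sub 1
    rw [sub_zero] at h1
    -- `(n - j - 1) / (n - 1) = 1 - j / (n - 1)`.
    refine h1.congr' ?_
    filter_upwards [eventually_ge_atTop (j + 2)] with n hn
    have h2 : (j : ℝ) + 2 ≤ n := by exact_mod_cast hn
    have h3 : (0 : ℝ) ≤ j := j.cast_nonneg
    have h4 : (n : ℝ) - 1 ≠ 0 := by linarith
    rw [Nat.cast_sub (by omega)]
    field_simp
    ring

/-! ### Numerical value of the limit -/

lemma abs_exp_neg_exp_sub_lt : |Real.exp (-Real.exp (-1)) - 0.692201| < 5 * 10 ^ (-7 : ℤ) := by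
  have hl := Real.exp_one_gt_d9
  have hu := Real.exp_one_lt_d9
  have h1 : (0.36787944 : ℝ) < Real.exp (-1) := by
    rw [Real.exp_neg, lt_inv_comm₀ (by norm_num) (Real.exp_pos _)]
    exact hu.trans (by norm_num)
  have h2 : Real.exp (-1) < (0.36787945 : ℝ) := by
    rw [Real.exp_neg, inv_lt_comm₀ (Real.exp_pos _) (by norm_num)]
    exact lt_trans (by norm_num) hl
  -- Ten Taylor terms at both ends of the bracket for `e⁻¹`; monotonicity of `exp` then encloses the
  -- limit.
  have a := Real.exp_bound (x := -0.36787944) (by norm_num [abs_le]) (n := 10) (by norm_num)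
  have b := Real.exp_bound (x := -0.36787945) (by norm_num [abs_le]) (n := 10) (by norm_num)
  rw [abs_le, abs_neg, abs_of_pos (by norm_num)] at a b
  have hupper : Real.exp (-0.36787944) ≤ 0.6922011 := by
    have h := a.2
    norm_num [Finset.sum_range_succ, Nat.factorial] at h ⊢
    linarith
  have hlower : 0.692200605 ≤ Real.exp (-0.36787945) := by
    have h := b.1
    norm_num [Finset.sum_range_succ, Nat.factorial] at h ⊢
    linarith
  have ha := (Real.exp_lt_exp.2 (neg_lt_neg h1)).trans_le hupper
  have hb := hlower.trans_lt (Real.exp_lt_exp.2 (neg_lt_neg h2))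
  rw [abs_lt, show (5 * 10 ^ (-7 : ℤ) : ℝ) = 0.0000005 by norm_num]
  constructor <;> linarith

end RandomSubtree

theorem theorem1 :
    Tendsto RandomSubtree.p atTop (𝓝 (Real.exp (-Real.exp (-1)))) ∧
    Tendsto RandomSubtree.q atTop (𝓝 (Real.exp (-Real.exp (-1)))) ∧
    |Real.exp (-Real.exp (-1)) - 0.692201| < 5 * 10 ^ (-7 : ℤ) :=
  ⟨RandomSubtree.tendsto_p, RandomSubtree.tendsto_q, RandomSubtree.abs_exp_neg_exp_sub_lt⟩
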